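/- **Theorem 1.** Let $(M,g)$ be a smooth (finite-dimensional) Riemannian manifold with Levi-Civita connection $\nabla$, and let $f\in C^\infty(M)$ satisfy $\|\operatorname{grad} f\|^2=g(\operatorname{grad} f,\operatorname{grad} f)<1$ on $M$, where $\operatorname{grad} f$ is the gradient of $f$ with respect to $g$. Let $\tilde g=g-df\otimes df$, which is a Riemannian metric on $M$, and let $\tilde I_c:(M,g)\to(M,\tilde g)$, $x\mapsto x$, be the identity map. For a smooth map $\varphi:(M,g)\to(N,h)$ between Riemannian manifolds, the tension field is $$\tau(\varphi)=\operatorname{trace}_g\nabla d\varphi=\sum_{i=1}^m\left[\nabla^{\varphi}_{e_i}d\varphi(e_i)-d\varphi(\nabla_{e_i}e_i)\right],$$ where $m=\dim M$, $\{e_i\}_{i=1}^m$ is a local orthonormal frame on $(M,g)$, and $\nabla^\varphi$ is the pull-back to $\varphi^{-1}TN$ of the Levi-Civita connection of $(N,h)$. Then at every point of $M$ $$\tau(\tilde I_c)=-\frac{\Delta f}{1-\|\operatorname{grad} f\|^2}\,\operatorname{grad} f,$$ where $\Delta f=\operatorname{trace}_g\operatorname{Hess}_f$, with $\operatorname{Hess}_f(X,Y)=g(\nabla_X\operatorname{grad}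 f,Y)$, is the Laplacian of $f$ with respect to $g$. -/

import Mathlib

open scoped Manifold ContDiff

noncomputable section
namespace RiemGeom

/-- The algebra behind the fundamental theorem of Riemannian geometry: the correction turning a
connection with torsion `t` and metric defect `d` into a torsion-free metric one. -/
lemma exists_contorsion {V : Type*} [NormedAddCommGroup V] [InnerProductSpace ℝ V]
    [FiniteDimensional ℝ V] (d : V →L[ℝ] V →L[ℝ] V →L[ℝ] ℝ) (t : V →L[ℝ] V →L[ℝ] V) :
    ∃ A : V →L[ℝ] V →L[ℝ] V, ∀ Y X Z, inner ℝ (A Y X) Z =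
      (d Y Z X + d X Z Y - d X Y Z - inner ℝ (t X Y) Z + inner ℝ (t X Z) Y
        + inner ℝ (t Y Z) X) / 2 := by
  let toD := (InnerProductSpace.toDual ℝ V).symm
  let L (Y X : V) : StrongDual ℝ V :=
    (2⁻¹ : ℝ) • ((d Y).flip X + (d X).flip Y - d X Y - innerSL ℝ (t X Y)
      + innerSL ℝ Y ∘L t X + innerSL ℝ X ∘L t Y)
  have hL (Y X Z : V) : L Y X Z = (d Y Z X + d X Z Y - d X Y Z - inner ℝ (t X Y) Z
      + inner ℝ (t X Z) Y + inner ℝ (t Y Z) X) / 2 := by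
    simp only [L, smul_apply, add_apply, sub_apply, ContinuousLinearMap.flip_apply,
      innerSL_apply_apply, ContinuousLinearMap.comp_apply, smul_eq_mul]
    rw [real_inner_comm Y, real_inner_comm X]
    ring
  let B : V →ₗ[ℝ] V →ₗ[ℝ] V :=
    LinearMap.mk₂ ℝ (fun Y X ↦ toD (L Y X))
      (fun Y Y' X ↦ by
        rw [← map_add]; congr 1; ext Z
        simp only [hL, add_apply, map_add, inner_add_left, inner_add_right]
        ring)
      (fun c Y X ↦ by
        have : c • toD (L Y X) = toD (c • L Y X) := by simp [toD]
        rw [this]; congr 1; ext Z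
        simp only [hL, smul_apply, map_smul, inner_smul_left,
          inner_smul_right, smul_eq_mul, conj_trivial]
        ring)
      (fun Y X X' ↦ by
        rw [← map_add]; congr 1; ext Z
        simp only [hL, add_apply, map_add, inner_add_left, inner_add_right]
        ring)
      (fun c Y X ↦ by
        have : c • toD (L Y X) = toD (c • L Y X) := by simp [toD]
        rw [this]; congr 1; ext Z
        simp only [hL, smul_apply, map_smul, inner_smul_left,
          inner_smul_right, smul_eq_mul, conj_trivial]
        ring)
  refine ⟨B.toContinuousBilinearMap, fun Y X Z ↦ ?_⟩
  rw [← hL]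
  exact InnerProductSpace.toDual_symm_apply

lemma contDiff_smulRight_self (E : Type*) [NormedAddCommGroup E] [NormedSpace ℝ E]
    {n : WithTop ℕ∞} :
    ContDiff ℝ n (fun l : E →L[ℝ] ℝ ↦ l.smulRight l) :=
  contDiff_id.smulRight contDiff_id

open Bundle FiberBundle

variable {E : Type*} [NormedAddCommGroup E] [NormedSpace ℝ E]
  {H : Type*} [TopologicalSpace H] {I : ModelWithCorners ℝ E H}
  {M : Type*} [TopologicalSpace M] [ChartedSpace H M]
  {E' : Type*} [NormedAddCommGroup E'] [NormedSpace ℝ E']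
  {H' : Type*} [TopologicalSpace H'] {J : ModelWithCorners ℝ E' H'}
  {N : Type*} [TopologicalSpace N] [ChartedSpace H' N]

lemma mvfderiv_congr {f₁ f₂ : M → E'} {x : M} (h : f₁ =ᶠ[nhds x] f₂) :
    mvfderiv I f₁ x = mvfderiv I f₂ x := by
  unfold mvfderiv
  ext v
  simp only [ContinuousLinearMap.comp_apply, h.mfderiv_eq]
  rfl

section
variable [IsManifold J ∞ N]

/-- Derivative at `x` of a vector field `σ` along `φ : M → N`, computed componentwise in the preferred
trivialization of `TN` at `φ x`. -/
def coordDeriv (φ : M → N) (σ : Π y : M, TangentSpace J (φ y)) (x : M) :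
    TangentSpace I x →L[ℝ] TangentSpace J (φ x) :=
  (trivializationAt E' (TangentSpace J : N → Type _) (φ x)).symmL ℝ (φ x) ∘L
    mvfderiv I (fun y ↦ (trivializationAt E' (TangentSpace J : N → Type _) (φ x)
      (TotalSpace.mk' E' (φ y) (σ y))).2) x

lemma mdiff_coord {φ : M → N} {σ : Π y : M, TangentSpace J (φ y)} {x : M}
    (hσ : MDifferentiableAt I (J.prod 𝓘(ℝ, E')) (fun y ↦ TotalSpace.mk' E' (φ y) (σ y)) x) :
    MDifferentiableAt I 𝓘(ℝ, E')
      (fun y ↦ (trivializationAt E' (TangentSpace J : N → Type _) (φ x)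
        (TotalSpace.mk' E' (φ y) (σ y))).2) x :=
  ((mdifferentiableAt_totalSpace _ _).1 hσ).2

lemma eventually_mem_baseSet {φ : M → N} {σ : Π y : M, TangentSpace J (φ y)} {x : M}
    (hσ : MDifferentiableAt I (J.prod 𝓘(ℝ, E')) (fun y ↦ TotalSpace.mk' E' (φ y) (σ y)) x) :
    ∀ᶠ y in nhds x, φ y ∈ (trivializationAt E' (TangentSpace J : N → Type _) (φ x)).baseSet :=
  ((mdifferentiableAt_totalSpace _ _).1 hσ).1.continuousAt.preimage_mem_nhds
    ((trivializationAt E' (TangentSpace J : N → Type _) (φ x)).open_baseSet.mem_nhds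
      (mem_baseSet_trivializationAt E' _ (φ x)))

lemma coordDeriv_add {φ : M → N} {σ τ : Π y : M, TangentSpace J (φ y)} {x : M}
    (hσ : MDifferentiableAt I (J.prod 𝓘(ℝ, E')) (fun y ↦ TotalSpace.mk' E' (φ y) (σ y)) x)
    (hτ : MDifferentiableAt I (J.prod 𝓘(ℝ, E')) (fun y ↦ TotalSpace.mk' E' (φ y) (τ y)) x) :
    coordDeriv (I := I) φ (fun y ↦ σ y + τ y) x = coordDeriv φ σ x + coordDeriv φ τ x := by
  unfold coordDeriv
  rw [← ContinuousLinearMap.comp_add, ← mvfderiv_add (mdiff_coord hσ) (mdiff_coord hτ)]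
  congr 1
  apply mvfderiv_congr
  filter_upwards [eventually_mem_baseSet hσ] with y hy
  exact ((trivializationAt E' (TangentSpace J : N → Type _) (φ x)).linear ℝ hy).map_add _ _

lemma coordDeriv_smul {φ : M → N} {a : M → ℝ} {σ : Π y : M, TangentSpace J (φ y)} {x : M}
    (ha : MDifferentiableAt I 𝓘(ℝ, ℝ) a x)
    (hσ : MDifferentiableAt I (J.prod 𝓘(ℝ, E')) (fun y ↦ TotalSpace.mk' E' (φ y) (σ y)) x) :
    coordDeriv (I := I) φ (fun y ↦ a y • σ y) x =
      a x • coordDeriv φ σ x + (mvfderiv I a x).smulRight (σ x) := by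
  have key : mvfderiv I (fun y ↦ (trivializationAt E' (TangentSpace J : N → Type _) (φ x)
      (TotalSpace.mk' E' (φ y) (a y • σ y))).2) x =
      mvfderiv I (a • fun y ↦ (trivializationAt E' (TangentSpace J : N → Type _) (φ x)
      (TotalSpace.mk' E' (φ y) (σ y))).2) x := by
    apply mvfderiv_congr
    filter_upwards [eventually_mem_baseSet hσ] with y hy
    exact ((trivializationAt E' (TangentSpace J : N → Type _) (φ x)).linear ℝ hy).map_smul _ _
  unfold coordDeriv
  rw [key, mvfderiv_smul ha (mdiff_coord hσ)]
  ext v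
  have hm := mem_baseSet_trivializationAt E' (TangentSpace J : N → Type _) (φ x)
  have := (trivializationAt E' (TangentSpace J : N → Type _) (φ x)).symm_apply_apply_mk hm (σ x)
  simp
  congr 2
  rwa [Trivialization.symmL_apply _ hm]


/-- The covariant derivative on `TN` which, at each point `p`, is the componentwise derivative in the
preferred trivialization at `p`. It is only an auxiliary base point for other connections. -/
def coordConnection : CovariantDerivative J E' (TangentSpace J : N → Type _) where
  toFun σ x := coordDeriv (φ := id) σ x
  isCovariantDerivativeOnUniv :=
    { add := fun hσ hτ _ ↦ coordDeriv_add (φ := id) hσ hτ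
      leibniz := fun hσ ha _ ↦ coordDeriv_smul (φ := id) ha hσ }

lemma coordConnection_extend (p : N) (w : TangentSpace J p) :
    coordConnection (extend E' w) p = 0 := by
  have : mvfderiv J (fun y ↦ (trivializationAt E' (TangentSpace J : N → Type _) p
      (TotalSpace.mk' E' y (extend E' w y))).2) p = 0 := by
    rw [mvfderiv_congr (f₂ := fun _ ↦ (trivializationAt E' (TangentSpace J : N → Type _) p
      (TotalSpace.mk' E' p w)).2)]
    · exact mvfderiv_const _
    · filter_upwards [(trivializationAt E' (TangentSpace J : N → Type _) p).open_baseSet.mem_nhds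
        (mem_baseSet_trivializationAt E' _ p)] with y hy
      simp [extend, (trivializationAt E' (TangentSpace J : N → Type _) p).apply_mk_symm hy]
  change _ ∘L mvfderiv J (fun y ↦ (trivializationAt E' (TangentSpace J : N → Type _) p
      (TotalSpace.mk' E' y (extend E' w y))).2) p = 0
  rw [this, ContinuousLinearMap.comp_zero]

/-- The pull-back connection `∇^φ` on `φ⁻¹TN` of a connection `D` on `TN`. In the frame `b_α` of `TN`
given by the preferred trivialization at `φ x`, a section `σ = ∑ σ^α (b_α ∘ φ)` has
`∇^φ_v σ = ∑ dσ^α(v) b_α + ∑ σ^α(x) D_{dφ(v)} b_α`. The lemmas `pullbackConnection_add`,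
`pullbackConnection_leibniz`, `pullbackConnection_comp` give the properties that characterize it. -/
def pullbackConnection (D : CovariantDerivative J E' (TangentSpace J : N → Type _))
    (φ : M → N) (σ : Π y : M, TangentSpace J (φ y)) (x : M) :
    TangentSpace I x →L[ℝ] TangentSpace J (φ x) :=
  coordDeriv φ σ x + D (extend E' (σ x)) (φ x) ∘L mfderiv I J φ x

lemma connection_eq [FiniteDimensional ℝ E']
    (D : CovariantDerivative J E' (TangentSpace J : N → Type _))
    {W : Π p : N, TangentSpace J p} {p : N} (hW : MDiffAt (T% W) p) :
    D W p = coordConnection W p + D (extend E' (W p)) p := by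
  have h1 := IsCovariantDerivativeOn.difference_apply D.isCovariantDerivativeOnUniv
    coordConnection.isCovariantDerivativeOnUniv (x := p) trivial hW
  have h2 := IsCovariantDerivativeOn.difference_apply D.isCovariantDerivativeOnUniv
    coordConnection.isCovariantDerivativeOnUniv (x := p) trivial
    (mdifferentiableAt_extend J E' (W p))
  rw [extend_apply_self, h1] at h2
  have h3 := coordConnection_extend p (W p)
  rw [h3, sub_zero] at h2
  rw [← h2]; abel

lemma connection_extend_add (D : CovariantDerivative J E' (TangentSpace J : N → Type _))
    {p : N} (v w : TangentSpace J p) :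
    D (extend E' (v + w)) p = D (extend E' v) p + D (extend E' w) p := by
  have hv := mdifferentiableAt_extend J E' v
  have hw := mdifferentiableAt_extend J E' w
  rw [← D.isCovariantDerivativeOnUniv.add hv hw trivial]
  refine D.isCovariantDerivativeOnUniv.congr_of_eventuallyEq (mdifferentiableAt_extend J E' _)
    (mdifferentiableAt_add_section hv hw) Filter.univ_mem ?_
  have hp := mem_baseSet_trivializationAt E' (TangentSpace J : N → Type _) p
  filter_upwards [(trivializationAt E' (TangentSpace J : N → Type _) p).open_baseSet.mem_nhds
    hp] with y hy
  simp only [extend, Pi.add_apply]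
  rw [((trivializationAt E' (TangentSpace J : N → Type _) p).linear ℝ hp).map_add]
  simp only [← Trivialization.symmL_apply (R := ℝ) _ hy, map_add]

lemma connection_extend_smul (D : CovariantDerivative J E' (TangentSpace J : N → Type _))
    {p : N} (c : ℝ) (v : TangentSpace J p) :
    D (extend E' (c • v)) p = c • D (extend E' v) p := by
  have hv := mdifferentiableAt_extend J E' v
  rw [← D.isCovariantDerivativeOnUniv.smul_const c hv trivial]
  refine D.isCovariantDerivativeOnUniv.congr_of_eventuallyEq (mdifferentiableAt_extend J E' _)
    (mdifferentiableAt_const.smul_section hv) Filter.univ_mem ?_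
  have hp := mem_baseSet_trivializationAt E' (TangentSpace J : N → Type _) p
  filter_upwards [(trivializationAt E' (TangentSpace J : N → Type _) p).open_baseSet.mem_nhds
    hp] with y hy
  simp only [extend, Pi.smul_apply]
  rw [((trivializationAt E' (TangentSpace J : N → Type _) p).linear ℝ hp).map_smul]
  simp only [← Trivialization.symmL_apply (R := ℝ) _ hy, map_smul]

lemma pullbackConnection_add (D : CovariantDerivative J E' (TangentSpace J : N → Type _))
    {φ : M → N} {σ τ : Π y : M, TangentSpace J (φ y)} {x : M}
    (hσ : MDifferentiableAt I (J.prod 𝓘(ℝ, E')) (fun y ↦ TotalSpace.mk' E' (φ y) (σ y)) x)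
    (hτ : MDifferentiableAt I (J.prod 𝓘(ℝ, E')) (fun y ↦ TotalSpace.mk' E' (φ y) (τ y)) x) :
    pullbackConnection (I := I) D φ (fun y ↦ σ y + τ y) x =
      pullbackConnection D φ σ x + pullbackConnection D φ τ x := by
  simp only [pullbackConnection, coordDeriv_add hσ hτ, connection_extend_add,
    ContinuousLinearMap.add_comp]
  abel

lemma pullbackConnection_leibniz (D : CovariantDerivative J E' (TangentSpace J : N → Type _))
    {φ : M → N} {a : M → ℝ} {σ : Π y : M, TangentSpace J (φ y)} {x : M}
    (ha : MDifferentiableAt I 𝓘(ℝ, ℝ) a x)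
    (hσ : MDifferentiableAt I (J.prod 𝓘(ℝ, E')) (fun y ↦ TotalSpace.mk' E' (φ y) (σ y)) x) :
    pullbackConnection (I := I) D φ (fun y ↦ a y • σ y) x =
      a x • pullbackConnection D φ σ x + (mvfderiv I a x).smulRight (σ x) := by
  simp only [pullbackConnection, coordDeriv_smul ha hσ, connection_extend_smul,
    ContinuousLinearMap.smul_comp, smul_add]
  abel

/-- `∇^φ_v (W ∘ φ) = D_{dφ(v)} W`. -/
lemma pullbackConnection_comp [FiniteDimensional ℝ E']
    (D : CovariantDerivative J E' (TangentSpace J : N → Type _))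
    {φ : M → N} {W : Π p : N, TangentSpace J p} {x : M}
    (hφ : MDifferentiableAt I J φ x) (hW : MDiffAt (T% W) (φ x)) :
    pullbackConnection (I := I) D φ (fun y ↦ W (φ y)) x = D W (φ x) ∘L mfderiv I J φ x := by
  rw [connection_eq D hW, ContinuousLinearMap.add_comp, pullbackConnection]
  congr 1
  change _ ∘L _ = (_ ∘L _) ∘L _
  rw [ContinuousLinearMap.comp_assoc]
  congr 1
  exact mfderiv_comp x (mdiff_coord (φ := id) hW) hφ

end

theorem contMDiff_differential_sq [IsManifold I ∞ M] {f : M → ℝ} (hf : ContMDiff I 𝓘(ℝ, ℝ) ∞ f) :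
    ContMDiff I (I.prod 𝓘(ℝ, E →L[ℝ] E →L[ℝ] ℝ)) ∞
      (fun x ↦ TotalSpace.mk' (E →L[ℝ] E →L[ℝ] ℝ)
        (E := fun x : M ↦ TangentSpace I x →L[ℝ] TangentSpace I x →L[ℝ] ℝ) x
        ((mvfderiv I f x).smulRight (mvfderiv I f x))) := by
  intro x
  rw [contMDiffAt_hom_bundle]
  refine ⟨contMDiffAt_id, ?_⟩
  have h := (hf x).mfderiv_const (m := ∞) (by simp)
  refine ((contDiff_smulRight_self E).contMDiff.contMDiffAt.comp x h).congr_of_eventuallyEq ?_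
  have hx := mem_baseSet_trivializationAt E (TangentSpace I : M → Type _) x
  filter_upwards [(trivializationAt E (TangentSpace I : M → Type _) x).open_baseSet.mem_nhds
    hx] with y hy
  ext v w
  have key (u : E) : inTangentCoordinates I 𝓘(ℝ, ℝ) id f (mfderiv I 𝓘(ℝ, ℝ) f) x y u =
      mvfderiv I f y ((trivializationAt E (TangentSpace I : M → Type _) x).symm y u) := by
    rw [← Trivialization.symmL_apply (R := ℝ) _ hy]
    change (trivializationAt ℝ (TangentSpace 𝓘(ℝ, ℝ)) (f x)).continuousLinearMapAt ℝ (f y)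
      (mfderiv I 𝓘(ℝ, ℝ) f y ((trivializationAt E (TangentSpace I) x).symmL ℝ y u)) = _
    rw [TangentBundle.continuousLinearMapAt_model_space]
    rfl
  rw [inCoordinates_apply_eq₂ hy hy (Set.mem_univ _)]
  simp [key]

section LeviCivita
variable [IsManifold I ∞ M] [FiniteDimensional ℝ E]

instance finiteDimensional_tangentSpace (x : M) : FiniteDimensional ℝ (TangentSpace I x) :=
  inferInstanceAs (FiniteDimensional ℝ E)

/-- The inner products on the tangent spaces given by the Riemannian metric `g`. -/
abbrev bundleOf (g : ContMDiffRiemannianMetric I ∞ E (TangentSpace I : M → Type _)) :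
    RiemannianBundle (TangentSpace I : M → Type _) := ⟨g.toRiemannianMetric⟩

/-- `D` is a Levi-Civita connection of `g`: torsion-free and compatible with `g`. -/
def IsLeviCivita (g : ContMDiffRiemannianMetric I ∞ E (TangentSpace I : M → Type _))
    (D : CovariantDerivative I E (TangentSpace I : M → Type _)) : Prop :=
  letI := bundleOf g
  D.torsion = 0 ∧
    CovariantDerivative.IsMetricCompatible (F := E) (V := (TangentSpace I : M → Type _)) D

/-- Existence of the Levi-Civita connection. -/
theorem exists_isLeviCivita
    (g : ContMDiffRiemannianMetric I ∞ E (TangentSpace I : M → Type _)) :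
    ∃ D, IsLeviCivita g D := by
  let ib := bundleOf g
  let D₀ : CovariantDerivative I E (TangentSpace I : M → Type _) := coordConnection
  let d := CovariantDerivative.derivMetricTensor (F := E)
    (V := (TangentSpace I : M → Type _)) D₀
  let t := D₀.torsion
  let a (x : M) (Y X Z : TangentSpace I x) : ℝ :=
    (d x Y Z X + d x X Z Y - d x X Y Z - inner ℝ (t x X Y) Z + inner ℝ (t x X Z) Y
      + inner ℝ (t x Y Z) X) / 2
  have hA : ∀ x, ∃ A : TangentSpace I x →L[ℝ] TangentSpace I x →L[ℝ] TangentSpace I x,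
      ∀ Y X Z, inner ℝ (A Y X) Z = a x Y X Z := by
    exact fun x ↦ exists_contorsion (d x) (t x)
  choose A hA using hA
  have dsymm (x : M) (X Y Z : TangentSpace I x) : d x X Y Z = d x Y X Z := by
    simp only [d, CovariantDerivative.derivMetricTensor_apply_eq_extend]
    simp only [real_inner_comm (FiberBundle.extend E X _), real_inner_comm X]
    rw [real_inner_comm]
    ring
  have tanti (x : M) (X Y : TangentSpace I x) : t x X Y = - t x Y X := D₀.torsion_antisymm X Y
  refine ⟨D₀.addOneForm A, ?_, ?_⟩
  · rw [CovariantDerivative.torsion_eq_zero_iff]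
    intro X Y x hX hY
    have h1 := D₀.torsion_apply hX hY
    have h2 : A x (Y x) (X x) - A x (X x) (Y x) = - t x (X x) (Y x) := by
      refine ext_inner_right ℝ fun Z ↦ ?_
      rw [inner_sub_left, hA, hA, inner_neg_left]
      simp only [a]
      rw [tanti x (Y x) (X x), inner_neg_left, dsymm x (Y x) (X x)]
      ring
    change (D₀ Y x (X x) + A x (Y x) (X x)) - (D₀ X x (Y x) + A x (X x) (Y x)) = _
    rw [add_sub_add_comm, h2]
    change D₀ Y x (X x) - D₀ X x (Y x) + - D₀.torsion x (X x) (Y x) = _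
    rw [h1]
    abel
  · rw [CovariantDerivative.isMetricCompatible_iff]
    intro x X Y Z hX hY hZ
    have h1 := CovariantDerivative.derivMetricTensor_apply (F := E)
      (V := (TangentSpace I : M → Type _)) D₀ (X := X) x hY hZ
    change _ = inner ℝ (D₀ Y x (X x) + A x (Y x) (X x)) (Z x) +
      inner ℝ (Y x) (D₀ Z x (X x) + A x (Z x) (X x))
    rw [inner_add_left, inner_add_right, real_inner_comm (A x (Z x) (X x)), hA, hA]
    have h2 : a x (Y x) (X x) (Z x) + a x (Z x) (X x) (Y x) = d x (Y x) (Z x) (X x) := by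
      simp only [a]
      rw [tanti x (Z x) (Y x), inner_neg_left, dsymm x (Z x) (Y x)]
      ring
    change d x (Y x) (Z x) (X x) = _ at h1
    dsimp only at h1 ⊢
    linarith


/-- The Levi-Civita connection of `g`; `leviCivita g Y x v` is `(∇_v Y)(x)`. (It is unique on
vector fields `Y` that are differentiable at `x`.) -/
def leviCivita (g : ContMDiffRiemannianMetric I ∞ E (TangentSpace I : M → Type _)) :
    CovariantDerivative I E (TangentSpace I : M → Type _) :=
  Classical.choose (exists_isLeviCivita g)

theorem isLeviCivita_leviCivita
    (g : ContMDiffRiemannianMetric I ∞ E (TangentSpace I : M → Type _)) :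
    IsLeviCivita g (leviCivita g) :=
  Classical.choose_spec (exists_isLeviCivita g)

/-- The trace with respect to `g` of a bilinear map on `T_xM`: `∑ B(e_i, e_i)` for a `g`-orthonormal
basis `e` of `T_xM`. -/
def metricTrace (g : ContMDiffRiemannianMetric I ∞ E (TangentSpace I : M → Type _)) (x : M)
    {W : Type*} [AddCommGroup W] (B : TangentSpace I x → TangentSpace I x → W) : W :=
  letI := bundleOf g
  letI e := stdOrthonormalBasis ℝ (TangentSpace I x)
  ∑ i, B (e i) (e i)

/-- The gradient of `f` with respect to `g`: `g(grad f, v) = df(v)`. -/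
def gradient (g : ContMDiffRiemannianMetric I ∞ E (TangentSpace I : M → Type _))
    (f : M → ℝ) (x : M) : TangentSpace I x :=
  letI := bundleOf g
  (InnerProductSpace.toDual ℝ (TangentSpace I x)).symm (mvfderiv I f x)

theorem inner_gradient (g : ContMDiffRiemannianMetric I ∞ E (TangentSpace I : M → Type _))
    (f : M → ℝ) (x : M) (v : TangentSpace I x) :
    g.inner x (gradient g f x) v = mvfderiv I f x v :=
  letI := bundleOf g
  InnerProductSpace.toDual_symm_apply (𝕜 := ℝ) (E := TangentSpace I x) (x := v)
    (y := mvfderiv I f x)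

/-- The Hessian of `f` with respect to `g`: `Hess_f(v, w) = g(∇_v grad f, w)`. -/
def hessian (g : ContMDiffRiemannianMetric I ∞ E (TangentSpace I : M → Type _))
    (f : M → ℝ) (x : M) (v w : TangentSpace I x) : ℝ :=
  g.inner x (leviCivita g (gradient g f) x v) w

/-- The Laplacian of `f` with respect to `g`: the trace of the Hessian. -/
def laplacian (g : ContMDiffRiemannianMetric I ∞ E (TangentSpace I : M → Type _))
    (f : M → ℝ) (x : M) : ℝ :=
  metricTrace g x (hessian g f x)

theorem sq_differential_le (g : ContMDiffRiemannianMetric I ∞ E (TangentSpace I : M → Type _))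
    (f : M → ℝ) (x : M) (v : TangentSpace I x) :
    mvfderiv I f x v * mvfderiv I f x v ≤
      g.inner x (gradient g f x) (gradient g f x) * g.inner x v v := by
  let _ := bundleOf g
  rw [← inner_gradient g]
  exact real_inner_mul_inner_self_le (F := TangentSpace I x) (gradient g f x) v

/-- The Riemannian metric `g - df ⊗ df`, for a smooth function `f` with `‖grad f‖² < 1`. -/
def deformedMetric (g : ContMDiffRiemannianMetric I ∞ E (TangentSpace I : M → Type _))
    (f : M → ℝ) (hf : ContMDiff I 𝓘(ℝ, ℝ) ∞ f)
    (hgrad : ∀ x, g.inner x (gradient g f x) (gradient g f x) < 1) :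
    ContMDiffRiemannianMetric I ∞ E (TangentSpace I : M → Type _) where
  inner x := g.inner x - (mvfderiv I f x).smulRight (mvfderiv I f x)
  symm x v w := by simp [g.symm x v w, mul_comm]
  pos x v hv := by
    have h1 := sq_differential_le g f x v
    have h2 := mul_lt_mul_of_pos_right (hgrad x) (g.pos x v hv)
    simp only [sub_apply, ContinuousLinearMap.smulRight_apply, smul_apply, smul_eq_mul]
    linarith
  isVonNBounded x := by
    let _ := bundleOf g
    have hc : 0 < 1 - g.inner x (gradient g f x) (gradient g f x) := sub_pos.2 (hgrad x)
    set c := 1 - g.inner x (gradient g f x) (gradient g f x) with hc'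
    have hb : Bornology.IsVonNBounded ℝ (Metric.ball (0 : TangentSpace I x) (1 + 1 / c)) :=
      NormedSpace.isVonNBounded_ball ℝ _ _
    refine hb.subset fun v hv ↦ ?_
    have h1 := sq_differential_le g f x v
    simp only [sub_apply, ContinuousLinearMap.smulRight_apply, smul_apply, smul_eq_mul,
      Set.mem_ofPred_eq] at hv
    have h3 : g.inner x v v = ‖v‖ * ‖v‖ := real_inner_self_eq_norm_mul_norm (F := TangentSpace I x) v
    have h4 : c * (‖v‖ * ‖v‖) < 1 := by rw [← h3]; nlinarith
    rw [mem_ball_zero_iff]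
    by_contra hcon
    have h5 : 1 + 1 / c ≤ ‖v‖ := not_lt.1 hcon
    have h6 : 0 < 1 / c := by positivity
    have h7 : 1 / c ≤ ‖v‖ * ‖v‖ := by nlinarith
    have h8 : c * (1 / c) = 1 := by field_simp
    nlinarith
  contMDiff := g.contMDiff.sub_section (contMDiff_differential_sq hf)

end LeviCivita

section Tension
variable [IsManifold I ∞ M] [FiniteDimensional ℝ E] [IsManifold J ∞ N] [FiniteDimensional ℝ E']

/-- The second fundamental form of `φ : (M, g) → (N, h)`,
`∇dφ(v, w) = ∇^φ_v (dφ(W)) - dφ(∇_v W)` for a local vector field `W` extending `w`. -/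
def secondFundamentalForm (g : ContMDiffRiemannianMetric I ∞ E (TangentSpace I : M → Type _))
    (h : ContMDiffRiemannianMetric J ∞ E' (TangentSpace J : N → Type _)) (φ : M → N) (x : M)
    (v w : TangentSpace I x) : TangentSpace J (φ x) :=
  pullbackConnection (leviCivita h) φ (fun y ↦ mfderiv I J φ y (extend E w y)) x v
    - mfderiv I J φ x (leviCivita g (extend E w) x v)

/-- The tension field `τ(φ) = trace_g ∇dφ` of `φ : (M, g) → (N, h)`. -/
def tensionField (g : ContMDiffRiemannianMetric I ∞ E (TangentSpace I : M → Type _))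
    (h : ContMDiffRiemannianMetric J ∞ E' (TangentSpace J : N → Type _)) (φ : M → N) (x : M) :
    TangentSpace J (φ x) :=
  metricTrace g x (secondFundamentalForm g h φ x)

end Tension
end RiemGeom

end

noncomputable section
namespace RiemGeom

/-! For the identity map, `∇dφ` is the difference `S = ∇̃ - ∇` of the Levi-Civita connections of
`g̃` and `g`. The theorem is the `g`-trace of a pointwise identity, `S(v, w) = -Hess_f(v, w) / (1 -
‖grad f‖²) · grad f`, which is `secondFundamentalForm_id_deformedMetric`.

To prove it, let `T(v, w)` be the left side minus the right. Since both connections are torsion-free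
and the Hessian is symmetric, `T` is symmetric. Since `∇` preserves `g`, `∇̃` preserves `g - df ⊗
df`, and `g̃(grad f, ·) = (1 - ‖grad f‖²) df`, the form `g̃(T(u, v), w)` is skew in `v, w`. By
`eq_zero_of_symm_of_skew` it vanishes, which is the uniqueness argument for the Levi-Civita
connection.

The remaining work is `hessian_symm`. It rests on smoothness of the gradient and on `[U, V]a = U(Va)
- V(Ua)`, which is extracted from the Jacobi identity. -/

/-- A trilinear form symmetric in the first two slots and skew in the last two vanishes. -/
lemma eq_zero_of_symm_of_skew {V : Type*} {c : V → V → V → ℝ}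
    (hs : ∀ u v w, c u v w = c v u w) (ha : ∀ u v w, c u v w + c u w v = 0) (u v w : V) :
    c u v w = 0 := by
  linarith [hs u v w, hs v w u, hs w u v, ha u v w, ha v w u, ha w u v]

open Bundle FiberBundle VectorField

variable {E : Type*} [NormedAddCommGroup E] [NormedSpace ℝ E]
  {H : Type*} [TopologicalSpace H] {I : ModelWithCorners ℝ E H}
  {M : Type*} [TopologicalSpace M] [ChartedSpace H M] [IsManifold I ∞ M]

/-! ### Smoothness of local extensions, of `df(V)` and of the gradient. -/

lemma contMDiffAt_extend_tangent {x : M} (v : TangentSpace I x) :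
    ContMDiffAt I (I.prod 𝓘(ℝ, E)) ∞ (T% (extend E v)) x := by
  rw [contMDiffAt_section]
  refine (contMDiffAt_const (c := (trivializationAt E (TangentSpace I : M → Type _) x
      (TotalSpace.mk' E x v)).2)).congr_of_eventuallyEq ?_
  filter_upwards [(trivializationAt E (TangentSpace I : M → Type _) x).open_baseSet.mem_nhds
    (mem_baseSet_trivializationAt E _ x)] with y hy
  simp [extend, (trivializationAt E (TangentSpace I : M → Type _) x).apply_mk_symm hy]

/-- The differential of `f`, written in the preferred trivialization of `TM` at `x`. -/
lemma inTangentCoordinates_mfderiv_apply (f : M → ℝ) {x y : M}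
    (hy : y ∈ (trivializationAt E (TangentSpace I : M → Type _) x).baseSet) (u : E) :
    inTangentCoordinates I 𝓘(ℝ, ℝ) id f (mfderiv I 𝓘(ℝ, ℝ) f) x y u =
      mvfderiv I f y ((trivializationAt E (TangentSpace I : M → Type _) x).symm y u) := by
  rw [← Trivialization.symmL_apply (R := ℝ) _ hy]
  change (trivializationAt ℝ (TangentSpace 𝓘(ℝ, ℝ)) (f x)).continuousLinearMapAt ℝ (f y)
    (mfderiv I 𝓘(ℝ, ℝ) f y ((trivializationAt E (TangentSpace I) x).symmL ℝ y u)) = _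
  rw [TangentBundle.continuousLinearMapAt_model_space]
  rfl

lemma contMDiffAt_mvfderiv_apply {f : M → ℝ} (hf : ContMDiff I 𝓘(ℝ, ℝ) ∞ f)
    {V : Π y : M, TangentSpace I y} {x : M}
    (hV : ContMDiffAt I (I.prod 𝓘(ℝ, E)) ∞ (T% V) x) :
    ContMDiffAt I 𝓘(ℝ, ℝ) ∞ (fun y ↦ mvfderiv I f y (V y)) x := by
  have hbs := (hf x).mfderiv_const (m := ∞) (by simp)
  rw [contMDiffAt_section] at hV
  refine (hbs.clm_apply hV).congr_of_eventuallyEq ?_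
  filter_upwards [(trivializationAt E (TangentSpace I : M → Type _) x).open_baseSet.mem_nhds
    (mem_baseSet_trivializationAt E _ x)] with y hy
  rw [inTangentCoordinates_mfderiv_apply f hy, Trivialization.symm_apply_apply_mk _ hy]

variable [FiniteDimensional ℝ E]

/-- In the trivialization at `x` the gradient is `A⁻¹ b`, with `A` the Gram form of `g` and `b` the
differential of `f`; operator inversion is smooth at invertible operators. This lets metric
compatibility be applied to `grad f`. -/
theorem contMDiff_gradient (g : ContMDiffRiemannianMetric I ∞ E (TangentSpace I : M → Type _))
    {f : M → ℝ} (hf : ContMDiff I 𝓘(ℝ, ℝ) ∞ f) :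
    ContMDiff I (I.prod 𝓘(ℝ, E)) ∞ (T% (gradient g f)) := by
  intro x
  rw [contMDiffAt_section]
  set e := trivializationAt E (TangentSpace I : M → Type _) x
  let A (y : M) : E →L[ℝ] E →L[ℝ] ℝ := ContinuousLinearMap.inCoordinates E (TangentSpace I)
    (E →L[ℝ] ℝ) (fun y : M ↦ TangentSpace I y →L[ℝ] ℝ) x y x y (g.inner y)
  let b (y : M) : E →L[ℝ] ℝ := inTangentCoordinates I 𝓘(ℝ, ℝ) id f (mfderiv I 𝓘(ℝ, ℝ) f) x y
  have hAs : ContMDiffAt I 𝓘(ℝ, E →L[ℝ] E →L[ℝ] ℝ) ∞ A x :=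
    ((contMDiffAt_hom_bundle _).1 (g.contMDiff x)).2
  have hbs : ContMDiffAt I 𝓘(ℝ, E →L[ℝ] ℝ) ∞ b x := (hf x).mfderiv_const (m := ∞) (by simp)
  have hA {y : M} (hy : y ∈ e.baseSet) (u w : E) :
      A y u w = g.inner y (e.symm y u) (e.symm y w) := by
    simp only [A]
    rw [inCoordinates_apply_eq₂ hy hy (Set.mem_univ _)]
    simp [e]
  -- Positive definiteness makes `A y : E → E*` injective, and equal dimensions make it bijective.
  have hinv {y : M} (hy : y ∈ e.baseSet) : (A y).IsInvertible := by
    have hinj : Function.Injective (A y) := by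
      rw [injective_iff_map_eq_zero]
      intro u hu
      by_contra hne
      have hsymm : e.symm y u ≠ 0 := by
        intro h0
        apply hne
        have h1 := congrArg Prod.snd (e.apply_mk_symm hy u)
        rw [h0] at h1
        rw [← show (e (TotalSpace.mk' E y 0)).2 = u from h1]
        exact (e.linear ℝ hy).map_zero
      have h2 := g.pos y _ hsymm
      rw [← hA hy, hu] at h2
      simp at h2
    refine ⟨(LinearEquiv.ofInjectiveOfFinrankEq (A y).toLinearMap hinj ?_).toContinuousLinearEquiv,
      ?_⟩
    · rw [← (LinearMap.toContinuousLinearMap : (E →ₗ[ℝ] ℝ) ≃ₗ[ℝ] E →L[ℝ] ℝ).finrank_eq]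
      exact (Subspace.dual_finrank_eq (K := ℝ) (V := E)).symm
    · rfl
  have hx := mem_baseSet_trivializationAt E (TangentSpace I : M → Type _) x
  have hs : ContMDiffAt I 𝓘(ℝ, E) ∞ (fun y ↦ (A y).inverse (b y)) x :=
    ((hinv hx).contDiffAt_map_inverse.contMDiffAt.comp x hAs).clm_apply hbs
  refine hs.congr_of_eventuallyEq ?_
  filter_upwards [e.open_baseSet.mem_nhds hx] with y hy
  have key : A y (e (TotalSpace.mk' E y (gradient g f y))).2 = b y := by
    ext w
    rw [hA hy, inTangentCoordinates_mfderiv_apply f hy w, ← inner_gradient g,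
      e.symm_apply_apply_mk hy]
  obtain ⟨L, hL⟩ := hinv hy
  rw [← key, ← hL]
  simp

/-! ### The Lie bracket as a commutator of derivations. -/

/-- `[V, aZ] = (Va) Z + a [V, Z]` as vector fields near `x`, so that it can be bracketed again. -/
lemma mlieBracket_mlieBracket_smul {a : M → ℝ} (ha : ContMDiff I 𝓘(ℝ, ℝ) ∞ a)
    {U V Z : Π y : M, TangentSpace I y} {x : M}
    (hV : ContMDiffAt I (I.prod 𝓘(ℝ, E)) ∞ (T% V) x)
    (hZ : ContMDiffAt I (I.prod 𝓘(ℝ, E)) ∞ (T% Z) x) :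
    mlieBracket I U (mlieBracket I V (a • Z)) x =
      mvfderiv I (fun y ↦ mvfderiv I a y (V y)) x (U x) • Z x
        + mvfderiv I a x (V x) • mlieBracket I U Z x
        + (mvfderiv I a x (U x) • mlieBracket I V Z x
        + a x • mlieBracket I U (mlieBracket I V Z) x) := by
  -- A bracket costs one derivative; `C¹` is all that a second bracket requires.
  have hVZ : ContMDiffAt I (I.prod 𝓘(ℝ, E)) ((1 : ℕ∞) : WithTop ℕ∞) (T% (mlieBracket I V Z)) x := by
    have : IsManifold I ((2 : ℕ∞) + 1) M := IsManifold.of_le (n := ∞) (by norm_cast)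
    have : IsManifold I (minSmoothness ℝ 2) M := IsManifold.of_le (n := ∞) (by
      rw [minSmoothness_of_isRCLikeNormedField]; norm_cast)
    refine ContMDiffAt.mlieBracket_vectorField (n := 2) (hV.of_le ?_) (hZ.of_le ?_) ?_
    · norm_cast
    · norm_cast
    · rw [minSmoothness_of_isRCLikeNormedField]; norm_cast
  have hVZ' := hVZ.mdifferentiableAt (by simp)
  have haV := (contMDiffAt_mvfderiv_apply ha hV).mdifferentiableAt (by simp)
  have hZ1 := hZ.mdifferentiableAt (by simp)
  have ha1 : MDifferentiable I 𝓘(ℝ, ℝ) a := ha.mdifferentiable (by simp)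
  have hev : mlieBracket I V (a • Z) =ᶠ[nhds x]
      (fun y ↦ mvfderiv I a y (V y)) • Z + a • mlieBracket I V Z := by
    have h1 : ∀ᶠ y in nhds x, ContMDiffAt I (I.prod 𝓘(ℝ, E)) 1 (T% Z) y :=
      (contMDiffAt_iff_contMDiffAt_nhds (by simp)).1 (hZ.of_le (by norm_cast))
    filter_upwards [h1] with y hy
    exact mlieBracket_smul_right (ha1 y) (hy.mdifferentiableAt (by simp))
  rw [Filter.EventuallyEq.mlieBracket_vectorField_eq (Filter.EventuallyEq.refl _ U) hev,
    mlieBracket_add_right (haV.smul_section hZ1) ((ha1 x).smul_section hVZ'),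
    mlieBracket_smul_right haV hZ1, mlieBracket_smul_right (ha1 x) hVZ']

/-- The Lie bracket acts on functions as the commutator of derivations. -/
theorem mvfderiv_mlieBracket {a : M → ℝ} (ha : ContMDiff I 𝓘(ℝ, ℝ) ∞ a)
    {U V : Π y : M, TangentSpace I y} {x : M}
    (hU : ContMDiffAt I (I.prod 𝓘(ℝ, E)) ∞ (T% U) x)
    (hV : ContMDiffAt I (I.prod 𝓘(ℝ, E)) ∞ (T% V) x) :
    mvfderiv I a x (mlieBracket I U V x) =
      mvfderiv I (fun y ↦ mvfderiv I a y (V y)) x (U x)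
        - mvfderiv I (fun y ↦ mvfderiv I a y (U y)) x (V x) := by
  -- The argument below needs a nonzero tangent vector; in dimension zero both sides vanish.
  rcases subsingleton_or_nontrivial E with hE | hE
  · have h0 (v : TangentSpace I x) : v = 0 := Subsingleton.elim (α := E) _ _
    rw [h0 (mlieBracket I U V x), h0 (U x), h0 (V x)]
    simp
  obtain ⟨z, hz⟩ : ∃ z : TangentSpace I x, z ≠ 0 := exists_ne (α := E) 0
  set Z := extend E z (x := x) (E := (TangentSpace I : M → Type _))
  have hZx : Z x = z := extend_apply_self _ _
  have hZ : ContMDiffAt I (I.prod 𝓘(ℝ, E)) ∞ (T% Z) x := contMDiffAt_extend_tangent z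
  have h2 : (minSmoothness ℝ 2 : WithTop ℕ∞) ≤ ∞ := by
    rw [minSmoothness_of_isRCLikeNormedField]; norm_cast
  have : IsManifold I (minSmoothness ℝ 3) M := IsManifold.of_le (n := ∞) (by
    rw [minSmoothness_of_isRCLikeNormedField]; norm_cast)
  have hZ1 := hZ.mdifferentiableAt (by simp)
  have haZ : ContMDiffAt I (I.prod 𝓘(ℝ, E)) ∞ (T% (a • Z)) x := (ha x).smul_section hZ
  -- Expand Jacobi for `U, V, aZ` and subtract `a` times Jacobi for `U, V, Z`. The first-order terms
  -- cancel, leaving `([U, V]a - U(Va) + V(Ua)) Z = 0` at `x`, where `Z` is nonzero.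
  have J1 := leibniz_identity_mlieBracket_apply (hU.of_le h2) (hV.of_le h2) (haZ.of_le h2)
  have J2 := leibniz_identity_mlieBracket_apply (hU.of_le h2) (hV.of_le h2) (hZ.of_le h2)
  rw [mlieBracket_mlieBracket_smul ha hV hZ, mlieBracket_mlieBracket_smul ha hU hZ,
    mlieBracket_smul_right (ha.mdifferentiable (by simp) x) hZ1, J2, hZx] at J1
  have key : (mvfderiv I a x (mlieBracket I U V x) -
      (mvfderiv I (fun y ↦ mvfderiv I a y (V y)) x (U x)
        - mvfderiv I (fun y ↦ mvfderiv I a y (U y)) x (V x))) • z = 0 := by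
    rw [← neg_eq_zero, ← sub_eq_zero.2 J1]
    module
  have := (smul_eq_zero.1 key).resolve_right hz
  linarith

/-! ### Levi-Civita identities and the symmetry of the Hessian. -/

theorem leviCivita_mvfderiv_inner
    (g : ContMDiffRiemannianMetric I ∞ E (TangentSpace I : M → Type _))
    {Y Z : Π y : M, TangentSpace I y} {x : M} (hY : MDiffAt (T% Y) x) (hZ : MDiffAt (T% Z) x)
    (v : TangentSpace I x) :
    mvfderiv I (fun y ↦ g.inner y (Y y) (Z y)) x v =
      g.inner x (leviCivita g Y x v) (Z x) + g.inner x (Y x) (leviCivita g Z x v) := by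
  let _ := bundleOf g
  have h := CovariantDerivative.IsMetricCompatible.mvfderiv_inner_eq (F := E)
    (V := (TangentSpace I : M → Type _)) (isLeviCivita_leviCivita g).2 (extend E v) hY hZ
  simp only [extend_apply_self] at h
  exact h

/-- The right side does not involve the metric, so the antisymmetric parts of two Levi-Civita
connections agree. -/
theorem leviCivita_sub_swap
    (g : ContMDiffRiemannianMetric I ∞ E (TangentSpace I : M → Type _))
    {x : M} (v w : TangentSpace I x) :
    leviCivita g (extend E w) x v - leviCivita g (extend E v) x w =
      mlieBracket I (extend E v) (extend E w) x := by
  have h := (CovariantDerivative.torsion_eq_zero_iff (leviCivita g)).1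
    (isLeviCivita_leviCivita g).1 (mdifferentiableAt_extend I E v) (mdifferentiableAt_extend I E w)
  simpa only [extend_apply_self] using h

/-- Metric compatibility applied to `g(grad f, W) = df(W)`. -/
theorem hessian_eq (g : ContMDiffRiemannianMetric I ∞ E (TangentSpace I : M → Type _))
    {f : M → ℝ} (hf : ContMDiff I 𝓘(ℝ, ℝ) ∞ f) {x : M} (v : TangentSpace I x)
    {W : Π y : M, TangentSpace I y} (hW : MDiffAt (T% W) x) :
    hessian g f x v (W x) = mvfderiv I (fun y ↦ mvfderiv I f y (W y)) x v
      - mvfderiv I f x (leviCivita g W x v) := by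
  have h := leviCivita_mvfderiv_inner g ((contMDiff_gradient g hf).mdifferentiable (by simp) x) hW v
  simp only [inner_gradient] at h
  rw [hessian]
  linarith

/-- By `hessian_eq` the difference of the two sides is `V(Wf) - W(Vf) - df(∇_V W - ∇_W V)`;
torsion-freeness turns the last argument into `[V, W]`. -/
theorem hessian_symm (g : ContMDiffRiemannianMetric I ∞ E (TangentSpace I : M → Type _))
    {f : M → ℝ} (hf : ContMDiff I 𝓘(ℝ, ℝ) ∞ f) {x : M} (v w : TangentSpace I x) :
    hessian g f x v w = hessian g f x w v := by
  have h1 := hessian_eq g hf v (mdifferentiableAt_extend I E w)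
  have h2 := hessian_eq g hf w (mdifferentiableAt_extend I E v)
  have h3 := mvfderiv_mlieBracket hf (contMDiffAt_extend_tangent v) (contMDiffAt_extend_tangent w)
  rw [← leviCivita_sub_swap g, map_sub] at h3
  simp only [extend_apply_self] at h1 h2 h3
  linarith

/-! ### Comparison of the two connections, and the trace. -/

/-- `∇dφ` for the identity map is the difference of the two Levi-Civita connections. -/
theorem secondFundamentalForm_id
    (g h : ContMDiffRiemannianMetric I ∞ E (TangentSpace I : M → Type _)) {x : M}
    (v w : TangentSpace I x) :
    secondFundamentalForm g h (id : M → M) x v w =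
      leviCivita h (extend E w) x v - leviCivita g (extend E w) x v := by
  have h1 := pullbackConnection_comp (I := I) (leviCivita h) (φ := (id : M → M)) (x := x)
    mdifferentiableAt_id (mdifferentiableAt_extend I E w)
  have h2 : (fun y ↦ mfderiv I I (id : M → M) y (extend E w y)) = fun y ↦ extend E w (id y) := by
    funext y
    rw [mfderiv_id]
    rfl
  rw [secondFundamentalForm, h2]
  rw [h1, mfderiv_id]
  rfl

theorem secondFundamentalForm_id_deformedMetric
    (g : ContMDiffRiemannianMetric I ∞ E (TangentSpace I : M → Type _))
    (f : M → ℝ) (hf : ContMDiff I 𝓘(ℝ, ℝ) ∞ f)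
    (hgrad : ∀ x, g.inner x (gradient g f x) (gradient g f x) < 1) {x : M}
    (v w : TangentSpace I x) :
    secondFundamentalForm g (deformedMetric g f hf hgrad) (id : M → M) x v w =
      -(hessian g f x v w / (1 - g.inner x (gradient g f x) (gradient g f x))) •
        gradient g f x := by
  set h := deformedMetric g f hf hgrad with hh
  set G := gradient g f x
  have hpos : 0 < 1 - g.inner x G G := sub_pos.2 (hgrad x)
  have hinner (y : M) (a b : TangentSpace I y) :
      h.inner y a b = g.inner y a b - mvfderiv I f y a * mvfderiv I f y b := by
    simp [hh, deformedMetric]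
  -- The source of the denominator: `grad f` is dual to `df` under the new metric only up to this
  -- factor.
  have hG (b : TangentSpace I x) :
      h.inner x G b = (1 - g.inner x G G) * mvfderiv I f x b := by
    rw [hinner, inner_gradient, inner_gradient]; ring
  -- The defect in the claimed formula; it is shown to vanish.
  let T (v w : TangentSpace I x) : TangentSpace I x :=
    leviCivita h (extend E w) x v - leviCivita g (extend E w) x v
      + (hessian g f x v w / (1 - g.inner x G G)) • G
  have hT (u v w : TangentSpace I x) : h.inner x (T u v) w =
      h.inner x (leviCivita h (extend E v) x u) w - h.inner x (leviCivita g (extend E v) x u) w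
        + hessian g f x u v * mvfderiv I f x w := by
    simp only [T, map_add, map_sub, map_smul, add_apply, sub_apply, smul_apply, smul_eq_mul, hG]
    field_simp
  have hsymm (u v : TangentSpace I x) : T u v = T v u := by
    have h1 := leviCivita_sub_swap g u v
    have h2 := leviCivita_sub_swap h u v
    simp only [T, hessian_symm g hf u v]
    rw [← h1] at h2
    congr 1
    exact sub_eq_sub_iff_sub_eq_sub.1 h2
  have hskew (u v w : TangentSpace I x) : h.inner x (T u v) w + h.inner x (T u w) v = 0 := by
    have hv := mdifferentiableAt_extend I E v
    have hw := mdifferentiableAt_extend I E w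
    have dg := leviCivita_mvfderiv_inner g hv hw u
    have dh := leviCivita_mvfderiv_inner h hv hw u
    have Hv := hessian_eq g hf u hv
    have Hw := hessian_eq g hf u hw
    have sv := (contMDiffAt_mvfderiv_apply hf (contMDiffAt_extend_tangent v)).mdifferentiableAt
      (by simp)
    have sw := (contMDiffAt_mvfderiv_apply hf (contMDiffAt_extend_tangent w)).mdifferentiableAt
      (by simp)
    have sg : MDifferentiableAt I 𝓘(ℝ, ℝ)
        (fun y ↦ g.inner y (extend E v y) (extend E w y)) x := by
      let _ := bundleOf g
      exact MDifferentiableAt.inner_bundle (F := E) (E := (TangentSpace I : M → Type _))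
        (b := id) hv hw
    -- Differentiate `g(v, w) - df(v) df(w)` along `u`. The `g` part is given by `dg`; the
    -- derivatives of `df(v)` and `df(w)` combine with `df(∇_u v)` and `df(∇_u w)` into the Hessian
    -- terms of `T`.
    simp only [hinner] at dh
    rw [mvfderiv_fun_sub sg (g' := fun y ↦ mvfderiv I f y (extend E v y) *
      mvfderiv I f y (extend E w y)) (sv.mul sw)] at dh
    rw [sub_apply, mvfderiv_fun_mul sv sw, dg] at dh
    simp only [extend_apply_self, add_apply, smul_apply, smul_eq_mul] at dh Hv Hw
    rw [hT, hT]
    simp only [hinner]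
    rw [Hv, Hw]
    rw [g.symm x v, g.symm x v] at dh
    linear_combination -dh
  -- Pairing `T v w` with itself contradicts positivity of `h`.
  have hzero : T v w = 0 := by
    by_contra hne
    have h1 := h.pos x _ hne
    rw [eq_zero_of_symm_of_skew (c := fun u v w ↦ h.inner x (T u v) w)
      (fun u v w ↦ by rw [hsymm]) hskew v w] at h1
    exact lt_irrefl _ h1
  rw [secondFundamentalForm_id, neg_smul]
  exact eq_neg_of_add_eq_zero_left hzero

/-- Both traces run over the same `g`-orthonormal basis, so the sums agree term by term. -/
theorem tensionField_id_deformedMetric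
    (g : ContMDiffRiemannianMetric I ∞ E (TangentSpace I : M → Type _))
    (f : M → ℝ) (hf : ContMDiff I 𝓘(ℝ, ℝ) ∞ f)
    (hgrad : ∀ x, g.inner x (gradient g f x) (gradient g f x) < 1) (x : M) :
    tensionField g (deformedMetric g f hf hgrad) (id : M → M) x =
      -(laplacian g f x / (1 - g.inner x (gradient g f x) (gradient g f x))) •
        gradient g f x := by
  simp only [tensionField, laplacian, metricTrace]
  rw [Finset.sum_div, ← Finset.sum_neg_distrib, Finset.sum_smul]
  exact Finset.sum_congr rfl fun i _ ↦ secondFundamentalForm_id_deformedMetric g f hf hgrad _ _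

end RiemGeom

end


theorem theorem1
    {E : Type*} [NormedAddCommGroup E] [NormedSpace ℝ E] [FiniteDimensional ℝ E]
    {M : Type*} [TopologicalSpace M] [ChartedSpace E M] [IsManifold 𝓘(ℝ, E) ∞ M]
    (g : Bundle.ContMDiffRiemannianMetric 𝓘(ℝ, E) ∞ E (TangentSpace 𝓘(ℝ, E) : M → Type _))
    (f : M → ℝ) (hf : ContMDiff 𝓘(ℝ, E) 𝓘(ℝ, ℝ) ∞ f)
    (hgrad : ∀ x, g.inner x (RiemGeom.gradient g f x) (RiemGeom.gradient g f x) < 1)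
    (x : M) :
    RiemGeom.tensionField g (RiemGeom.deformedMetric g f hf hgrad) (id : M → M) x =
      -(RiemGeom.laplacian g f x /
          (1 - g.inner x (RiemGeom.gradient g f x) (RiemGeom.gradient g f x))) •
        RiemGeom.gradient g f x :=
  RiemGeom.tensionField_id_deformedMetric g f hf hgrad x
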